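/- A $k$-ary faro word ($k\ge 1$) of length $n\ge 0$ is a word $u_1v_1u_2v_2u_3v_3\cdots$ over the alphabet $\{1,\dots,k\}$ obtained by interlacing two nondecreasing words $u,v$ over $\{1,\dots,k\}$ with $0\le |u|-|v|\le 1$ and $|u|+|v|=n$. For $p\in\{11,12,21\}$, an occurrence of $p$ in a word $w$ is a position $i$, $1\le i<|w|$, with $w_i=w_{i+1}$ if $p=11$, $w_i<w_{i+1}$ if $p=12$, and $w_i>w_{i+1}$ if $p=21$. Let $F_p(x,y,z)$ be the formal power series in which the coefficient of $x^ny^kz^t$ is, for $n,t\ge 0$ and $k\ge 1$, the number of $k$-ary faro words of length $n$ containing exactly $t$ occurrences of $p$, and is $0$ for $k=0$. Then, in the field of fractions of $\mathbb{Q}[[x,y,z]]$, $$F_{11}(x,y,z)=\frac{2y(xz-x-1)}{-xyz+xy+x^3z-x^3+y-x^2+xz+x-1+(xz-x-1)A_1},$$ $$F_{21}(x,y,z)=\frac{2y}{-y+x^2z-2x+1+A_2},$$ $$F_{12}(x,y,z)=\frac{y\left(x^3z^2-x^3z+x^2z+xyz-xy-3xz+x+y-1+(xz-x+1)A_2\right)}{\left(x^3z^2-x^3z+x^2z-xyz+xy-xz-x-y+1+(xz-x+1)A_2\right)(-1+y)z}+\frac{y}{1-y},$$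 where $A_1=\sqrt{x^4-2x^2y-2x^2+y^2-2y+1}$ and $A_2=\sqrt{x^4z^2-2x^2yz-2x^2z+y^2-2y+1}$ are the formal power series square roots with constant term $1$ (they exist), and all denominators are nonzero. -/

import Mathlib

/-- The faro shuffle `u₁ v₁ u₂ v₂ u₃ v₃ …` of two words. -/
def faroShuffle {α : Type*} : List α → List α → List α
  | [], v => v
  | a :: u, v => a :: faroShuffle v u
termination_by u v => u.length + v.length
decreasing_by simp only [List.length_cons]; omega

/-- A faro word: a faro shuffle of two nondecreasing words `u`, `v` with `0 ≤ |u| - |v| ≤ 1`. -/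
def IsFaro {α : Type*} [LE α] (w : List α) : Prop :=
  ∃ u v : List α, u.Pairwise (· ≤ ·) ∧ v.Pairwise (· ≤ ·) ∧
    v.length ≤ u.length ∧ u.length ≤ v.length + 1 ∧ w = faroShuffle u v

/-- The (consecutive) factor of `w` of length `|p|` starting at (0-based) position `i` exists and is
order-isomorphic to the pattern `p`. -/
def OccursAt {α : Type*} [LT α] (p : List ℕ) (w : List α) (i : ℕ) : Prop :=
  ∃ h : i + p.length ≤ w.length, ∀ a b : Fin p.length,
    (w[i + a.val]'(by have := a.isLt; omega) < w[i + b.val]'(by have := b.isLt; omega)) ↔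
      p[a.val] < p[b.val]

/-- The number of occurrences of the consecutive pattern `p` in the word `w`. -/
noncomputable def occurrences {α : Type*} [LT α] (p : List ℕ) (w : List α) : ℕ :=
  {i : ℕ | OccursAt p w i}.ncard

/-- The number of `k`-ary faro words of length `n` with exactly `t` occurrences of the consecutive
pattern `p`; the alphabet is the `k`-element chain `Fin k`. -/
noncomputable def faroCount (p : List ℕ) (n k t : ℕ) : ℕ :=
  {w : List (Fin k) | w.length = n ∧ IsFaro w ∧ occurrences p w = t}.ncard

/-- Formal power series over `ℚ` in three variables. -/
abbrev PS3 : Type := MvPowerSeries (Fin 3) ℚ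

/-- The field of fractions of the ring of formal power series in three variables. -/
abbrev PS3Frac : Type := FractionRing PS3

/-- The trivariate generating function `F_p(x, y, z)`: for `k ≥ 1` the coefficient of `x^n y^k z^t`
is the number of `k`-ary faro words of length `n` with exactly `t` occurrences of `p`.
Alphabets are nonempty, so that there is no term with `k = 0`. -/
noncomputable def faroGF (p : List ℕ) : PS3 :=
  fun m => if m 1 = 0 then 0 else (faroCount p (m 0) (m 1) (m 2) : ℚ)

/-- `A` is the formal square root of `R` with constant term `1`. -/
def IsFormalSqrt (A R : PS3) : Prop :=
  A ^ 2 = R ∧ MvPowerSeries.constantCoeff A = 1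

-- A word is faro exactly when each letter is at least the letter two places before it
-- (`faroFrom_iff`). Reading from left to right, the state is the last two letters `a`, `b`. By
-- translation invariance the total weight of the continuations depends only on the gap between `a`
-- and `b`, its direction, and the number of letters above the larger one.
--
-- Let `A d` and `B e` be the generating functions for `b = a + d` and `a = b + e`. Classifying the
-- next letter gives, with `x`, `y` marking length and letters above, `A 0 = 1 + x ζ₁₁ A 0 + y B 1`,
-- `A (d+1) = A d + x ζ₂₁ B (d+1)`, `B e = 1 + x ζ₁₂ A e + y B (e+1)`.
--
-- This infinite system is solved by the kernel method (`descSeries_zero_eq`). Let `s` be the root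
-- without constant term of `s² = (1 + y - x² ζ₁₂ ζ₂₁) s - y`. Then `T e = x ζ₁₂ A e + 1 + (s - 1) B
-- e` satisfies `T e = s T (e+1)`, so `T 0` is divisible by every power of `s` and vanishes. With
-- the equations for `A 0` and `B 0` this determines `B 0`, from which the series of all faro words
-- follows (`faroSeries_faroWeight`). The three patterns are the cases where one weight is `z` and
-- the others are `1`; the discriminant involves only `ζ₁₂ ζ₂₁`, so 12 and 21 share a square root.

-- Faro words as a condition on letters two apart.

theorem faroShuffle_cons {α : Type*} (a : α) (u v : List α) :
    faroShuffle (a :: u) v = a :: faroShuffle v u := by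
  rw [faroShuffle]

theorem faroShuffle_nil_left {α : Type*} (v : List α) : faroShuffle [] v = v := by
  rw [faroShuffle]

/-- `FaroFrom p q l` says that `l` may follow the letters `p`, `q` in a faro word. -/
def FaroFrom {α : Type*} [LE α] : α → α → List α → Prop
  | _, _, [] => True
  | p, q, c :: l => p ≤ c ∧ FaroFrom q c l

theorem pairwise_le_cons_cons {α : Type*} [Preorder α] (a b : α) (l : List α) :
    (a :: b :: l).Pairwise (· ≤ ·) ↔ a ≤ b ∧ (b :: l).Pairwise (· ≤ ·) := by
  constructor
  · intro h
    exact ⟨(List.pairwise_cons.1 h).1 b (by simp), (List.pairwise_cons.1 h).2⟩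
  · rintro ⟨hab, h⟩
    refine List.pairwise_cons.2 ⟨fun c hc => ?_, h⟩
    rcases List.mem_cons.1 hc with rfl | hc
    · exact hab
    · exact hab.trans ((List.pairwise_cons.1 h).1 c hc)

/-- Removing the first letter of a shuffle swaps the roles of the two words, and the length
condition is preserved by this swap. -/
theorem faroFrom_iff {α : Type*} [Preorder α] (l : List α) (p q : α) :
    FaroFrom p q l ↔ ∃ u v : List α, (p :: u).Pairwise (· ≤ ·) ∧ (q :: v).Pairwise (· ≤ ·) ∧
      v.length ≤ u.length ∧ u.length ≤ v.length + 1 ∧ l = faroShuffle u v := by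
  induction l generalizing p q with
  | nil =>
    simp only [FaroFrom, true_iff]
    exact ⟨[], [], by simp, by simp, by simp, by simp, by rw [faroShuffle_nil_left]⟩
  | cons c l ih =>
    rw [FaroFrom, ih]
    constructor
    · rintro ⟨hpc, v, u, hv, hu, h₁, h₂, rfl⟩
      exact ⟨c :: u, v, (pairwise_le_cons_cons _ _ _).2 ⟨hpc, hu⟩, hv, by simpa using h₂,
        by simpa using h₁, by rw [faroShuffle_cons]⟩
    · rintro ⟨u, v, hu, hv, h₁, h₂, h⟩
      rcases u with _ | ⟨a, u⟩
      · simp only [List.length_nil, Nat.le_zero, List.length_eq_zero_iff] at h₁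
        subst h₁
        simp [faroShuffle_nil_left] at h
      · rw [faroShuffle_cons, List.cons.injEq] at h
        obtain ⟨rfl, rfl⟩ := h
        have hu' := (pairwise_le_cons_cons _ _ _).1 hu
        exact ⟨hu'.1, v, u, hv, hu'.2, by simpa using h₂, by simpa using h₁, rfl⟩

theorem isFaro_nil {α : Type*} [LE α] : IsFaro ([] : List α) :=
  ⟨[], [], by simp, by simp, by simp, by simp, by rw [faroShuffle_nil_left]⟩

/-- A virtual letter `⊥` in front of the word imposes no condition, so the first letter needs no
separate treatment. -/
theorem isFaro_cons_iff {α : Type*} [Preorder α] [OrderBot α] (q : α) (l : List α) :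
    IsFaro (q :: l) ↔ FaroFrom ⊥ q l := by
  rw [faroFrom_iff]
  constructor
  · rintro ⟨u, v, hu, hv, h₁, h₂, h⟩
    rcases u with _ | ⟨a, u⟩
    · simp only [List.length_nil, Nat.le_zero, List.length_eq_zero_iff] at h₁
      subst h₁
      simp [faroShuffle_nil_left] at h
    · rw [faroShuffle_cons, List.cons.injEq] at h
      obtain ⟨rfl, rfl⟩ := h
      exact ⟨v, u, List.pairwise_cons.2 ⟨fun _ _ => bot_le, hv⟩, hu, by simpa using h₂,
        by simpa using h₁, rfl⟩
  · rintro ⟨v, u, hv, hu, h₁, h₂, rfl⟩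
    exact ⟨q :: u, v, hu, (List.pairwise_cons.1 hv).2, by simpa using h₂, by simpa using h₁,
      by rw [faroShuffle_cons]⟩

-- Occurrences of a pattern of length two as a product of weights.

theorem occursAt_cons_succ {α : Type*} [LT α] (p : List ℕ) (a : α) (w : List α) (i : ℕ) :
    OccursAt p (a :: w) (i + 1) ↔ OccursAt p w i := by
  simp only [OccursAt, Nat.add_right_comm i 1, List.getElem_cons_succ, List.length_cons,
    Nat.add_le_add_iff_right]

theorem finite_setOf_occursAt {α : Type*} [LT α] (p : List ℕ) (w : List α) :
    {i : ℕ | OccursAt p w i}.Finite :=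
  (Set.finite_Iic w.length).subset fun _ hi => by
    obtain ⟨h, -⟩ := hi
    exact Set.mem_Iic.2 (by omega)

open Classical in
theorem occurrences_cons {α : Type*} [LT α] (p : List ℕ) (a : α) (w : List α) :
    occurrences p (a :: w) = (if OccursAt p (a :: w) 0 then 1 else 0) + occurrences p w := by
  have himg : (Nat.succ '' {i : ℕ | OccursAt p w i}).ncard = occurrences p w :=
    Set.ncard_image_of_injective _ Nat.succ_injective
  have hfin : (Nat.succ '' {i : ℕ | OccursAt p w i}).Finite :=
    (finite_setOf_occursAt p w).image _
  split_ifs with h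
  · have : {i : ℕ | OccursAt p (a :: w) i} =
        insert 0 (Nat.succ '' {i : ℕ | OccursAt p w i}) := by
      ext i
      cases i with
      | zero => simpa using h
      | succ i => simp [occursAt_cons_succ]
    rw [occurrences, this, Set.ncard_insert_of_notMem (by simp) hfin, himg, add_comm]
  · have : {i : ℕ | OccursAt p (a :: w) i} = Nat.succ '' {i : ℕ | OccursAt p w i} := by
      ext i
      cases i with
      | zero => simpa using h
      | succ i => simp [occursAt_cons_succ]
    rw [occurrences, this, himg, zero_add]

theorem occurrences_eq_zero {α : Type*} [LT α] {p : List ℕ} {w : List α}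
    (h : w.length < p.length) : occurrences p w = 0 := by
  have : {i : ℕ | OccursAt p w i} = ∅ := by
    ext i
    simp only [Set.mem_ofPred_eq, Set.mem_empty_iff_false, iff_false]
    rintro ⟨h', -⟩
    omega
  rw [occurrences, this, Set.ncard_empty]

theorem occursAt_pair_zero {α : Type*} [Preorder α] (i j : ℕ) (a b : α) (w : List α) :
    OccursAt [i, j] (a :: b :: w) 0 ↔ (a < b ↔ i < j) ∧ (b < a ↔ j < i) := by
  simp [OccursAt, Fin.forall_fin_two]

/-- The weight of two consecutive letters, according to the pattern that they form. -/
def pairWeight {R α : Type*} [LinearOrder α] (z₁₁ z₁₂ z₂₁ : R) (a b : α) : R :=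
  if a < b then z₁₂ else if a = b then z₁₁ else z₂₁

open Polynomial in
/-- The occurrences of `p` are marked by giving the weights `z₁₁`, `z₁₂`, `z₂₁` to the pairs of
consecutive letters. -/
structure MarkedBy (p : List ℕ) (z₁₁ z₁₂ z₂₁ : ℚ[X]) : Prop where
  length_eq : p.length = 2
  cons_cons : ∀ {α : Type} [LinearOrder α] (a b : α) (w : List α),
    (X : ℚ[X]) ^ occurrences p (a :: b :: w) =
      pairWeight z₁₁ z₁₂ z₂₁ a b * X ^ occurrences p (b :: w)

open Polynomial in
theorem markedBy_level : MarkedBy [1, 1] X 1 1 where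
  length_eq := rfl
  cons_cons a b w := by
    rw [occurrences_cons, pow_add, pairWeight]
    rcases lt_trichotomy a b with h | h | h
    · simp [occursAt_pair_zero, h]
    · simp [occursAt_pair_zero, h]
    · simp [occursAt_pair_zero, h, h.not_gt, h.ne']

open Polynomial in
theorem markedBy_ascent : MarkedBy [1, 2] 1 X 1 where
  length_eq := rfl
  cons_cons a b w := by
    rw [occurrences_cons, pow_add, pairWeight]
    rcases lt_trichotomy a b with h | h | h
    · simp [occursAt_pair_zero, h, h.not_gt]
    · simp [occursAt_pair_zero, h]
    · simp [occursAt_pair_zero, h.not_gt, h.ne']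

open Polynomial in
theorem markedBy_descent : MarkedBy [2, 1] 1 1 X where
  length_eq := rfl
  cons_cons a b w := by
    rw [occurrences_cons, pow_add, pairWeight]
    rcases lt_trichotomy a b with h | h | h
    · simp [occursAt_pair_zero, h, h.not_gt]
    · simp [occursAt_pair_zero, h]
    · simp [occursAt_pair_zero, h, h.not_gt, h.ne']

-- Enumeration of faro words letter by letter.

/-- The words of length `n` that may follow the letters `a`, `b` in a faro word. -/
def faroConts {k : ℕ} : ℕ → Fin k → Fin k → Finset (List (Fin k))
  | 0, _, _ => {[]}
  | n + 1, a, b => (Finset.Ici a).biUnion fun c => (faroConts n b c).image (c :: ·)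

theorem mem_faroConts {k : ℕ} (n : ℕ) (a b : Fin k) (l : List (Fin k)) :
    l ∈ faroConts n a b ↔ l.length = n ∧ FaroFrom a b l := by
  induction n generalizing a b l with
  | zero =>
    rw [faroConts, Finset.mem_singleton, List.length_eq_zero_iff]
    exact ⟨fun h => ⟨h, h ▸ trivial⟩, fun h => h.1⟩
  | succ n ih =>
    cases l with
    | nil => simp [faroConts]
    | cons c l => simp [faroConts, FaroFrom, ih, and_left_comm]

theorem sum_biUnion_image_cons {α M : Type*} [DecidableEq α] [AddCommMonoid M] (s : Finset α)
    (f : α → Finset (List α)) (g : List α → M) :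
    ∑ l ∈ s.biUnion (fun c => (f c).image (c :: ·)), g l = ∑ c ∈ s, ∑ l ∈ f c, g (c :: l) := by
  rw [Finset.sum_biUnion]
  · exact Finset.sum_congr rfl fun c _ =>
      Finset.sum_image fun _ _ _ _ h => (List.cons.inj h).2
  · intro a _ b _ hab
    refine Finset.disjoint_left.2 fun l ha hb => hab ?_
    obtain ⟨_, _, rfl⟩ := Finset.mem_image.1 ha
    obtain ⟨_, _, h⟩ := Finset.mem_image.1 hb
    exact (List.cons.inj h).1.symm

/-- The faro words of length `n` over an alphabet with `m + 1` letters. -/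
noncomputable def faroWords (m : ℕ) : ℕ → Finset (List (Fin (m + 1)))
  | 0 => {[]}
  | n + 1 => Finset.univ.biUnion fun c => (faroConts n ⊥ c).image (c :: ·)

theorem mem_faroWords (m n : ℕ) (w : List (Fin (m + 1))) :
    w ∈ faroWords m n ↔ w.length = n ∧ IsFaro w := by
  cases n with
  | zero =>
    rw [faroWords, Finset.mem_singleton, List.length_eq_zero_iff]
    exact ⟨fun h => ⟨h, h ▸ isFaro_nil⟩, fun h => h.1⟩
  | succ n =>
    cases w with
    | nil => simp [faroWords]
    | cons c l => simp [faroWords, mem_faroConts, isFaro_cons_iff]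

open Polynomial in
theorem faroCount_succ_eq_coeff (p : List ℕ) (n m t : ℕ) :
    (faroCount p n (m + 1) t : ℚ) =
      (∑ w ∈ faroWords m n, (X : ℚ[X]) ^ occurrences p w).coeff t := by
  have : {w : List (Fin (m + 1)) | w.length = n ∧ IsFaro w ∧ occurrences p w = t} =
      ↑((faroWords m n).filter fun w => t = occurrences p w) := by
    ext w
    simp [mem_faroWords, and_assoc, eq_comm]
  rw [faroCount, this, Set.ncard_coe_finset, Polynomial.finsetSum_coeff]
  simp only [Polynomial.coeff_X_pow, Finset.sum_boole]

-- Weights of continuations in terms of gaps.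

section Recursion

variable {R : Type*} [CommSemiring R] (z₁₁ z₁₂ z₂₁ : R)

mutual
/-- The total weight of the words of length `n` that may follow two letters `a`, `b` with
`b = a + d`, when there are `m` letters above `b`. -/
def ascWeight : ℕ → ℕ → ℕ → R
  | 0, _, _ => 1
  | n + 1, d, m => z₂₁ * ∑ i ∈ Finset.range d, descWeight n (d - i) m + (z₁₁ * ascWeight n 0 m +
      z₁₂ * ∑ j ∈ Finset.range m, ascWeight n (j + 1) (m - 1 - j))
/-- The total weight of the words of length `n` that may follow two letters `a`, `b` with
`a = b + e`, when there are `m` letters above `a`. -/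
def descWeight : ℕ → ℕ → ℕ → R
  | 0, _, _ => 1
  -- For `e > 0` every admissible next letter exceeds `b`, hence the common factor `z₁₂`. At `e = 0`
  -- this is a mere convention: the next letter equal to `b` also gets `z₁₂`. It makes the recursion
  -- in `e` uniform, and `e = 0` then yields `z₁₂` times the sum over first letters.
  | n + 1, e, m => z₁₂ * ∑ j ∈ Finset.range (m + 1), ascWeight n (e + j) (m - j)
end

end Recursion

theorem sum_Ici_fin {M : Type*} [AddCommMonoid M] {k : ℕ} (a : Fin k) (f : ℕ → M) :
    ∑ c ∈ Finset.Ici a, f c = ∑ c ∈ Finset.Ico (a : ℕ) k, f c :=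
  Finset.sum_bij (fun c _ => (c : ℕ))
    (fun c hc => Finset.mem_Ico.2 ⟨Fin.le_def.1 (Finset.mem_Ici.1 hc), c.2⟩)
    (fun _ _ _ _ h => Fin.ext h)
    (fun c hc => ⟨⟨c, (Finset.mem_Ico.1 hc).2⟩,
      Finset.mem_Ici.2 (Fin.le_def.2 (Finset.mem_Ico.1 hc).1), rfl⟩)
    (fun _ _ => rfl)

section Weights

open Polynomial

variable {p : List ℕ} {z₁₁ z₁₂ z₂₁ : ℚ[X]}

theorem MarkedBy.sum_faroConts (h : MarkedBy p z₁₁ z₁₂ z₂₁) {k : ℕ} (n : ℕ) (a b : Fin k) :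
    ∑ l ∈ faroConts n a b, (X : ℚ[X]) ^ occurrences p (b :: l) =
      if (a : ℕ) ≤ b then ascWeight z₁₁ z₁₂ z₂₁ n (b - a) (k - 1 - b)
      else descWeight z₁₁ z₁₂ z₂₁ n (a - b) (k - 1 - a) := by
  induction n generalizing a b with
  | zero =>
    rw [faroConts, Finset.sum_singleton, occurrences_eq_zero (by simp [h.length_eq])]
    simp [ascWeight, descWeight]
  | succ n ih =>
    have key : ∑ l ∈ faroConts (n + 1) a b, (X : ℚ[X]) ^ occurrences p (b :: l) =
        ∑ c ∈ Finset.Ico (a : ℕ) k, pairWeight z₁₁ z₁₂ z₂₁ (b : ℕ) c *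
          if (b : ℕ) ≤ c then ascWeight z₁₁ z₁₂ z₂₁ n (c - b) (k - 1 - c)
          else descWeight z₁₁ z₁₂ z₂₁ n (b - c) (k - 1 - b) := by
      rw [← sum_Ici_fin, faroConts, sum_biUnion_image_cons]
      refine Finset.sum_congr rfl fun c _ => ?_
      rw [← ih b c, Finset.mul_sum]
      refine Finset.sum_congr rfl fun l _ => ?_
      rw [h.cons_cons]
      simp only [pairWeight, Fin.lt_def, Fin.ext_iff]
    rw [key]
    have hb := b.2
    have ha := a.2
    split_ifs with hab
    -- The next letter `c` is below, equal to, or above `b`; these are the three terms of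
    -- `ascWeight`.
    · rw [← Finset.sum_Ico_consecutive _ hab hb.le, Finset.sum_eq_sum_Ico_succ_bot hb,
        Finset.sum_Ico_eq_sum_range, Finset.sum_Ico_eq_sum_range, ascWeight, Finset.mul_sum,
        Finset.mul_sum]
      refine congr_arg₂ _ (Finset.sum_congr rfl fun i hi => ?_) (congr_arg₂ _ ?_ ?_)
      · have hi := Finset.mem_range.1 hi
        rw [pairWeight, if_neg (by omega), if_neg (by omega), if_neg (by omega), Nat.sub_add_eq]
      · simp [pairWeight]
      · refine Finset.sum_congr (by congr 1; omega) fun i hi => ?_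
        rw [pairWeight, if_pos (by omega), if_pos (by omega)]
        congr 2 <;> omega
    · rw [Finset.sum_Ico_eq_sum_range, descWeight, Finset.mul_sum]
      refine Finset.sum_congr (by congr 1; omega) fun i hi => ?_
      rw [pairWeight, if_pos (by omega), if_pos (by omega)]
      congr 2 <;> omega

/-- The total weight of the faro words of length `n` over an alphabet with `m + 1` letters. -/
noncomputable def faroWeight (z₁₁ z₁₂ z₂₁ : ℚ[X]) : ℕ → ℕ → ℚ[X]
  | 0, _ => 1
  | n + 1, m => ∑ j ∈ Finset.range (m + 1), ascWeight z₁₁ z₁₂ z₂₁ n j (m - j)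

theorem MarkedBy.sum_faroWords (h : MarkedBy p z₁₁ z₁₂ z₂₁) (n m : ℕ) :
    ∑ w ∈ faroWords m n, (X : ℚ[X]) ^ occurrences p w = faroWeight z₁₁ z₁₂ z₂₁ n m := by
  cases n with
  | zero =>
    rw [faroWords, Finset.sum_singleton, occurrences_eq_zero (by simp [h.length_eq]), faroWeight,
      pow_zero]
  | succ n =>
    rw [faroWords, sum_biUnion_image_cons, faroWeight, ← Fin.sum_univ_eq_sum_range
      (fun j => ascWeight z₁₁ z₁₂ z₂₁ n j (m - j))]
    refine Finset.sum_congr rfl fun c _ => ?_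
    rw [h.sum_faroConts]
    simp [bot_eq_zero]

end Weights

-- Functional equations for the generating functions.

section Series

open Polynomial

/-- The power series whose coefficient of `x ^ n * y ^ m` is `f n m`, a polynomial in `z`. -/
def faroSeries (f : ℕ → ℕ → ℚ[X]) : PS3 :=
  fun m => (f (m 0) (m 1)).coeff (m 2)

theorem coeff_faroSeries (f : ℕ → ℕ → ℚ[X]) (m : Fin 3 →₀ ℕ) :
    MvPowerSeries.coeff m (faroSeries f) = (f (m 0) (m 1)).coeff (m 2) :=
  rfl

theorem faroSeries_add (f g : ℕ → ℕ → ℚ[X]) :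
    faroSeries f + faroSeries g = faroSeries fun n m => f n m + g n m := by
  ext m
  simp [coeff_faroSeries]

theorem coeff_X_mul_eq_ite {σ R : Type*} [CommSemiring R] (s : σ) (f : MvPowerSeries σ R)
    (m : σ →₀ ℕ) : MvPowerSeries.coeff m (MvPowerSeries.X s * f) =
      if m s = 0 then 0 else MvPowerSeries.coeff (m - Finsupp.single s 1) f := by
  classical
  rw [MvPowerSeries.X, MvPowerSeries.coeff_monomial_mul]
  simp only [Finsupp.single_le_iff, one_mul]
  split_ifs <;> first | rfl | omega

theorem one_eq_faroSeries :
    (1 : PS3) = faroSeries fun n m => if n = 0 ∧ m = 0 then 1 else 0 := by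
  classical
  ext m
  rw [coeff_faroSeries, MvPowerSeries.coeff_one]
  have : m = 0 ↔ (m 0 = 0 ∧ m 1 = 0) ∧ m 2 = 0 := by
    simp [Finsupp.ext_iff, Fin.forall_fin_succ, and_assoc]
  by_cases h : m 0 = 0 ∧ m 1 = 0 <;> simp [this, h, Polynomial.coeff_one]

theorem X_zero_mul_faroSeries (f : ℕ → ℕ → ℚ[X]) :
    MvPowerSeries.X 0 * faroSeries f =
      faroSeries fun n m => if n = 0 then 0 else f (n - 1) m := by
  ext m
  rw [coeff_X_mul_eq_ite, coeff_faroSeries, coeff_faroSeries]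
  split_ifs <;> simp

theorem X_one_mul_faroSeries (f : ℕ → ℕ → ℚ[X]) :
    MvPowerSeries.X 1 * faroSeries f =
      faroSeries fun n m => if m = 0 then 0 else f n (m - 1) := by
  ext m
  rw [coeff_X_mul_eq_ite, coeff_faroSeries, coeff_faroSeries]
  split_ifs <;> simp

/-- Multiplication by `ζ` is multiplication of the coefficients in `ℚ[z]` by the polynomial `z`. -/
def IsWeightSeries (z : ℚ[X]) (ζ : PS3) : Prop :=
  ∀ f : ℕ → ℕ → ℚ[X], ζ * faroSeries f = faroSeries fun n m => z * f n m

theorem isWeightSeries_one : IsWeightSeries 1 1 := fun f => by simp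

theorem isWeightSeries_X : IsWeightSeries X (MvPowerSeries.X 2) := fun f => by
  ext m
  rw [coeff_X_mul_eq_ite, coeff_faroSeries, coeff_faroSeries]
  rcases h : m 2 with _ | t <;> simp [h]

theorem MarkedBy.faroGF_eq {p : List ℕ} {z₁₁ z₁₂ z₂₁ : ℚ[X]} (h : MarkedBy p z₁₁ z₁₂ z₂₁) :
    faroGF p = MvPowerSeries.X 1 * faroSeries (faroWeight z₁₁ z₁₂ z₂₁) := by
  ext m
  rw [X_one_mul_faroSeries, coeff_faroSeries]
  change (if m 1 = 0 then (0 : ℚ) else _) = _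
  rcases hm : m 1 with _ | k
  · simp
  · simp [faroCount_succ_eq_coeff, h.sum_faroWords]

variable {z₁₁ z₁₂ z₂₁ : ℚ[X]} {ζ₁₁ ζ₁₂ ζ₂₁ : PS3}

variable (z₁₁ z₁₂ z₂₁) in
/-- The generating function of `ascWeight`. -/
noncomputable def ascSeries (d : ℕ) : PS3 :=
  faroSeries fun n m => ascWeight z₁₁ z₁₂ z₂₁ n d m

variable (z₁₁ z₁₂ z₂₁) in
/-- The generating function of `descWeight`. -/
noncomputable def descSeries (e : ℕ) : PS3 :=
  faroSeries fun n m => descWeight z₁₁ z₁₂ z₂₁ n e m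

/-- When `a = b`, the next letters above `b` are those allowed if `a` were one step higher, with one
letter fewer above: this is the term in `descSeries` at 1. -/
theorem ascSeries_zero (h₁₁ : IsWeightSeries z₁₁ ζ₁₁) :
    ascSeries z₁₁ z₁₂ z₂₁ 0 = 1 + MvPowerSeries.X 0 * (ζ₁₁ * ascSeries z₁₁ z₁₂ z₂₁ 0) +
      MvPowerSeries.X 1 * descSeries z₁₁ z₁₂ z₂₁ 1 := by
  rw [ascSeries, descSeries, h₁₁, X_zero_mul_faroSeries, X_one_mul_faroSeries, one_eq_faroSeries,
    faroSeries_add, faroSeries_add]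
  congr 1
  funext n m
  rcases n with _ | n <;> rcases m with _ | m <;>
    simp [ascWeight, descWeight, add_comm]

/-- Lowering `a` by one step allows exactly one more next letter, `a` itself, which makes a descent
of size `d + 1`. -/
theorem ascSeries_succ (h₂₁ : IsWeightSeries z₂₁ ζ₂₁) (d : ℕ) :
    ascSeries z₁₁ z₁₂ z₂₁ (d + 1) = ascSeries z₁₁ z₁₂ z₂₁ d +
      MvPowerSeries.X 0 * (ζ₂₁ * descSeries z₁₁ z₁₂ z₂₁ (d + 1)) := by
  rw [ascSeries, ascSeries, descSeries, h₂₁, X_zero_mul_faroSeries, faroSeries_add]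
  congr 1
  funext n m
  rcases n with _ | n
  · simp [ascWeight]
  · simp [ascWeight, Finset.sum_range_succ', mul_add]
    ring

/-- Split off the smallest next letter, `a` itself; the others are those allowed when `a` is raised
by one step. -/
theorem descSeries_eq (h₁₂ : IsWeightSeries z₁₂ ζ₁₂) (e : ℕ) :
    descSeries z₁₁ z₁₂ z₂₁ e = 1 + MvPowerSeries.X 0 * (ζ₁₂ * ascSeries z₁₁ z₁₂ z₂₁ e) +
      MvPowerSeries.X 1 * descSeries z₁₁ z₁₂ z₂₁ (e + 1) := by
  rw [ascSeries, descSeries, descSeries, h₁₂, X_zero_mul_faroSeries, X_one_mul_faroSeries,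
    one_eq_faroSeries, faroSeries_add, faroSeries_add]
  congr 1
  funext n m
  rcases n with _ | n <;> rcases m with _ | m <;>
    simp [descWeight, Finset.sum_range_succ', mul_add, add_comm, add_left_comm]

theorem faroSeries_faroWeight (h₁₂ : IsWeightSeries z₁₂ ζ₁₂) :
    (1 - MvPowerSeries.X 1) * (ζ₁₂ * faroSeries (faroWeight z₁₁ z₁₂ z₂₁)) =
      (1 - MvPowerSeries.X 1) * descSeries z₁₁ z₁₂ z₂₁ 0 + ζ₁₂ - 1 := by
  -- `g = 1 / (1 - y)` collects the terms of length 0, the only ones where `z₁₂ * faroWeight` and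
  -- `descWeight` at gap 0 differ.
  set g : PS3 := faroSeries fun n _ => if n = 0 then 1 else 0 with hg
  have h₁ : g = 1 + MvPowerSeries.X 1 * g := by
    rw [hg, X_one_mul_faroSeries, one_eq_faroSeries, faroSeries_add]
    congr 1
    funext n m
    rcases n with _ | n <;> rcases m with _ | m <;> simp
  have h₂ : ζ₁₂ * faroSeries (faroWeight z₁₁ z₁₂ z₂₁) + g =
      descSeries z₁₁ z₁₂ z₂₁ 0 + ζ₁₂ * g := by
    rw [hg, h₁₂, h₁₂, descSeries, faroSeries_add, faroSeries_add]
    congr 1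
    funext n m
    rcases n with _ | n <;> simp [faroWeight, descWeight, add_comm]
  linear_combination (1 - MvPowerSeries.X 1) * h₂ + (ζ₁₂ - 1) * h₁

end Series

-- Power series tools and the kernel method.

theorem eq_zero_of_forall_pow_dvd {σ R : Type*} [CommRing R] {s f : MvPowerSeries σ R}
    (hs : MvPowerSeries.constantCoeff s = 0) (h : ∀ n : ℕ, s ^ n ∣ f) : f = 0 := by
  ext m
  obtain ⟨g, rfl⟩ := h (m.degree + 1)
  rw [map_zero]
  apply MvPowerSeries.coeff_of_lt_order
  calc (m.degree : ℕ∞) < ((m.degree + 1 : ℕ) : ℕ∞) := by exact_mod_cast Nat.lt_succ_self _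
    _ ≤ (s ^ (m.degree + 1)).order := MvPowerSeries.le_order_pow_of_constantCoeff_eq_zero _ hs
    _ ≤ (s ^ (m.degree + 1)).order + g.order := le_self_add
    _ ≤ _ := MvPowerSeries.le_order_mul

/-- Substitute `r - 1`, which has no constant term, into the binomial series of `(1 + X) ^ (1/2)`.
-/
theorem exists_isFormalSqrt {r : PS3} (hr : MvPowerSeries.constantCoeff r = 1) :
    ∃ s : PS3, IsFormalSqrt s r := by
  have hc : MvPowerSeries.constantCoeff (r - 1) = 0 := by simp [hr]
  have hsub : PowerSeries.HasSubst (r - 1) := PowerSeries.HasSubst.of_constantCoeff_zero hc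
  set b : PowerSeries ℚ := PowerSeries.binomialSeries ℚ (1 / 2 : ℚ) with hb
  have hb2 : b ^ 2 = 1 + PowerSeries.X := by
    rw [hb, pow_two, ← PowerSeries.binomialSeries_add]
    have := PowerSeries.binomialSeries_nat (R := ℚ) (A := ℚ) 1
    norm_num at this ⊢
    exact this
  -- In this form the constant term survives substitution visibly: the second summand becomes a
  -- multiple of `r - 1`.
  have hb1 : ∃ c : PowerSeries ℚ, b = 1 + PowerSeries.X * c := by
    have : PowerSeries.X ∣ b - 1 := by
      rw [PowerSeries.X_dvd_iff, map_sub, hb, PowerSeries.binomialSeries_constantCoeff]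
      simp
    obtain ⟨c, hc⟩ := this
    exact ⟨c, by rw [← hc]; ring⟩
  obtain ⟨c, hc'⟩ := hb1
  refine ⟨PowerSeries.substAlgHom hsub b, ?_, ?_⟩
  · rw [← map_pow, hb2, map_add, map_one, PowerSeries.substAlgHom_X]
    ring
  · rw [hc', map_add, map_one, map_mul, PowerSeries.substAlgHom_X, map_add, map_mul, hc]
    simp

/-- The kernel method: the combination `x * ζ₁₂ * A e + 1 + (s - 1) * B e` of the generating
functions at `e` is `s` times the one at `e + 1`, so that it is divisible by all powers of `s` and
vanishes. -/
theorem descSeries_zero_eq {z₁₁ z₁₂ z₂₁ : Polynomial ℚ} {ζ₁₁ ζ₁₂ ζ₂₁ S : PS3}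
    (h₁₁ : IsWeightSeries z₁₁ ζ₁₁) (h₁₂ : IsWeightSeries z₁₂ ζ₁₂) (h₂₁ : IsWeightSeries z₂₁ ζ₂₁)
    (hS : S ^ 2 = (1 + MvPowerSeries.X 1 - MvPowerSeries.X 0 ^ 2 * (ζ₁₂ * ζ₂₁)) ^ 2 -
      4 * MvPowerSeries.X 1) (hS₁ : MvPowerSeries.constantCoeff S = 1) :
    ((1 - MvPowerSeries.X 1 + MvPowerSeries.X 0 ^ 2 * (ζ₁₂ * ζ₂₁) + S) *
        (1 + MvPowerSeries.X 0 * ζ₁₂ - MvPowerSeries.X 0 * ζ₁₁) -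
        2 * (MvPowerSeries.X 0 * ζ₁₂)) * descSeries z₁₁ z₁₂ z₂₁ 0 =
      2 * (1 + MvPowerSeries.X 0 * ζ₁₂ - MvPowerSeries.X 0 * ζ₁₁) := by
  have hA₀ := ascSeries_zero (z₁₂ := z₁₂) (z₂₁ := z₂₁) h₁₁
  have hA := ascSeries_succ (z₁₁ := z₁₁) (z₁₂ := z₁₂) h₂₁
  have hB := descSeries_eq (z₁₁ := z₁₁) (z₂₁ := z₂₁) h₁₂
  set A := ascSeries z₁₁ z₁₂ z₂₁
  set B := descSeries z₁₁ z₁₂ z₂₁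
  set x : PS3 := MvPowerSeries.X 0 with hx
  set y : PS3 := MvPowerSeries.X 1 with hy
  set c : PS3 := MvPowerSeries.C (1 / 2 : ℚ) with hc
  have hc₂ : c * 2 = 1 := by
    have : (2 : PS3) = MvPowerSeries.C (2 : ℚ) := (map_ofNat MvPowerSeries.C 2).symm
    rw [hc, this, ← map_mul]
    norm_num
  -- The root of the kernel without constant term: the sign before `S` is chosen so that the
  -- constant terms cancel.
  set s : PS3 := c * (1 + y - x ^ 2 * (ζ₁₂ * ζ₂₁) - S) with hs
  have hs₂ : 2 * s = 1 + y - x ^ 2 * (ζ₁₂ * ζ₂₁) - S := by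
    linear_combination (1 + y - x ^ 2 * (ζ₁₂ * ζ₂₁) - S) * hc₂
  have hs₀ : MvPowerSeries.constantCoeff s = 0 := by simp [hs, hx, hy, hS₁]
  have hss : s ^ 2 = (1 + y - x ^ 2 * (ζ₁₂ * ζ₂₁)) * s - y := by
    have h4 : 4 * s ^ 2 = 4 * ((1 + y - x ^ 2 * (ζ₁₂ * ζ₂₁)) * s - y) := by
      linear_combination (2 * s - (1 + y - x ^ 2 * (ζ₁₂ * ζ₂₁)) - S) * hs₂ + hS
    linear_combination c ^ 2 * h4 + (c * 2 + 1) *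
      ((1 + y - x ^ 2 * (ζ₁₂ * ζ₂₁)) * s - y - s ^ 2) * hc₂
  have step (e : ℕ) : x * ζ₁₂ * A e + 1 + (s - 1) * B e =
      s * (x * ζ₁₂ * A (e + 1) + 1 + (s - 1) * B (e + 1)) := by
    linear_combination (s - 1) * hB e - x * ζ₁₂ * s * hA e - B (e + 1) * hss
  have hpow (n : ℕ) : x * ζ₁₂ * A 0 + 1 + (s - 1) * B 0 =
      s ^ n * (x * ζ₁₂ * A n + 1 + (s - 1) * B n) := by
    induction n with
    | zero => ring
    | succ n ih => rw [ih, step n]; ring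
  have hT := eq_zero_of_forall_pow_dvd hs₀ fun n => ⟨_, hpow n⟩
  -- Subtracting the equations for `A 0` and `B 0` eliminates `B 1` and gives `(1 + x ζ₁₂ - x ζ₁₁) A
  -- 0 = B 0`; inserting this in `T 0 = 0` leaves an equation for `B 0`.
  linear_combination (-2) * (1 + x * ζ₁₂ - x * ζ₁₁) * hT + 2 * x * ζ₁₂ * (hA₀ - hB 0)
    + (1 + x * ζ₁₂ - x * ζ₁₁) * B 0 * hs₂

-- The three generating functions.

theorem theorem3 :
    let X : PS3 := MvPowerSeries.X 0
    let Y : PS3 := MvPowerSeries.X 1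
    let Z : PS3 := MvPowerSeries.X 2
    let ι : PS3 → PS3Frac := algebraMap PS3 PS3Frac
    let x : PS3Frac := ι X
    let y : PS3Frac := ι Y
    let z : PS3Frac := ι Z
    ∃ S₁ S₂ : PS3,
      IsFormalSqrt S₁ (X ^ 4 - 2 * X ^ 2 * Y - 2 * X ^ 2 + Y ^ 2 - 2 * Y + 1) ∧
      IsFormalSqrt S₂
        (X ^ 4 * Z ^ 2 - 2 * X ^ 2 * Y * Z - 2 * X ^ 2 * Z + Y ^ 2 - 2 * Y + 1) ∧
      (let A₁ : PS3Frac := ι S₁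
       let A₂ : PS3Frac := ι S₂
       let D₁₁ : PS3Frac := -x * y * z + x * y + x ^ 3 * z - x ^ 3 + y - x ^ 2 + x * z + x - 1
         + (x * z - x - 1) * A₁
       let D₂₁ : PS3Frac := -y + x ^ 2 * z - 2 * x + 1 + A₂
       let D₁₂ : PS3Frac := (x ^ 3 * z ^ 2 - x ^ 3 * z + x ^ 2 * z - x * y * z + x * y - x * z
         - x - y + 1 + (x * z - x + 1) * A₂) * (-1 + y) * z
       (D₁₁ ≠ 0 ∧ ι (faroGF [1, 1]) = 2 * y * (x * z - x - 1) / D₁₁) ∧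
       (D₂₁ ≠ 0 ∧ ι (faroGF [2, 1]) = 2 * y / D₂₁) ∧
       (D₁₂ ≠ 0 ∧ 1 - y ≠ 0 ∧
         ι (faroGF [1, 2]) =
           y * (x ^ 3 * z ^ 2 - x ^ 3 * z + x ^ 2 * z + x * y * z - x * y - 3 * x * z
             + x + y - 1 + (x * z - x + 1) * A₂) / D₁₂ + y / (1 - y))) := by
  intro X Y Z ι x y z
  obtain ⟨S₁, hS₁⟩ := exists_isFormalSqrt
    (r := X ^ 4 - 2 * X ^ 2 * Y - 2 * X ^ 2 + Y ^ 2 - 2 * Y + 1) (by simp [X, Y])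
  obtain ⟨S₂, hS₂⟩ := exists_isFormalSqrt
    (r := X ^ 4 * Z ^ 2 - 2 * X ^ 2 * Y * Z - 2 * X ^ 2 * Z + Y ^ 2 - 2 * Y + 1)
    (by simp [X, Y])
  refine ⟨S₁, S₂, hS₁, hS₂, ?_⟩
  intro A₁ A₂ D₁₁ D₂₁ D₁₂
  have hι : ∀ f : PS3, ι f = 0 → f = 0 := fun f hf =>
    (IsFractionRing.injective PS3 PS3Frac) (hf.trans (map_zero (algebraMap PS3 PS3Frac)).symm)
  -- The denominators are nonzero because their constant terms are, apart from the factor `z` in the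
  -- case of 12.
  have hne : ∀ f : PS3, MvPowerSeries.constantCoeff f ≠ 0 → ι f ≠ 0 := fun f hf h =>
    hf (by rw [hι f h, map_zero])
  have e₁₁ := descSeries_zero_eq (S := S₁) isWeightSeries_X isWeightSeries_one isWeightSeries_one
    (by rw [hS₁.1]; ring) hS₁.2
  have f₁₁ := faroSeries_faroWeight (z₁₁ := Polynomial.X) (z₂₁ := 1) isWeightSeries_one
  have e₂₁ := descSeries_zero_eq (S := S₂) isWeightSeries_one isWeightSeries_one isWeightSeries_X
    (by rw [hS₂.1]; ring) hS₂.2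
  have f₂₁ := faroSeries_faroWeight (z₁₁ := 1) (z₂₁ := Polynomial.X) isWeightSeries_one
  have e₁₂ := descSeries_zero_eq (S := S₂) isWeightSeries_one isWeightSeries_X isWeightSeries_one
    (by rw [hS₂.1]; ring) hS₂.2
  have f₁₂ := faroSeries_faroWeight (z₁₁ := 1) (z₂₁ := 1) isWeightSeries_X
  have g₁₁ := markedBy_level.faroGF_eq
  have g₂₁ := markedBy_descent.faroGF_eq
  have g₁₂ := markedBy_ascent.faroGF_eq
  replace e₁₁ := congr_arg ι e₁₁
  replace f₁₁ := congr_arg ι f₁₁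
  replace e₂₁ := congr_arg ι e₂₁
  replace f₂₁ := congr_arg ι f₂₁
  replace e₁₂ := congr_arg ι e₁₂
  replace f₁₂ := congr_arg ι f₁₂
  replace g₁₁ := congr_arg ι g₁₁
  replace g₂₁ := congr_arg ι g₂₁
  replace g₁₂ := congr_arg ι g₁₂
  have hX : ι (MvPowerSeries.X 0) = x := rfl
  have hY : ι (MvPowerSeries.X 1) = y := rfl
  have hZ : ι (MvPowerSeries.X 2) = z := rfl
  have hadd : ∀ f g, ι (f + g) = ι f + ι g := map_add (algebraMap PS3 PS3Frac)
  have hsub : ∀ f g, ι (f - g) = ι f - ι g := map_sub (algebraMap PS3 PS3Frac)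
  have hmul : ∀ f g, ι (f * g) = ι f * ι g := map_mul (algebraMap PS3 PS3Frac)
  have hneg : ∀ f, ι (-f) = -ι f := map_neg (algebraMap PS3 PS3Frac)
  have hpow : ∀ f (n : ℕ), ι (f ^ n) = ι f ^ n := map_pow (algebraMap PS3 PS3Frac)
  have hone : ι 1 = 1 := map_one (algebraMap PS3 PS3Frac)
  have htwo : ι 2 = 2 := map_ofNat (algebraMap PS3 PS3Frac) 2
  have hy : 1 - y ≠ 0 := by
    have := hne (1 - Y) (by simp [Y])
    rwa [hsub, hone] at this
  have hz : z ≠ 0 := fun h => by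
    have := congr_arg (MvPowerSeries.coeff (Finsupp.single 2 1)) (hι Z h)
    simp [Z] at this
  have hD₁₁ : D₁₁ ≠ 0 := by
    have := hne (-X * Y * Z + X * Y + X ^ 3 * Z - X ^ 3 + Y - X ^ 2 + X * Z + X - 1
      + (X * Z - X - 1) * S₁) (by simp [X, Y, Z, hS₁.2])
    simpa only [hadd, hsub, hmul, hpow, hneg, hone] using this
  have hD₂₁ : D₂₁ ≠ 0 := by
    have := hne (-Y + X ^ 2 * Z - 2 * X + 1 + S₂) (by simp [X, Y, Z, hS₂.2])
    simpa only [hadd, hsub, hmul, hpow, hneg, hone, htwo] using this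
  have hE₁₂ : x ^ 3 * z ^ 2 - x ^ 3 * z + x ^ 2 * z - x * y * z + x * y - x * z
      - x - y + 1 + (x * z - x + 1) * A₂ ≠ 0 := by
    have := hne (X ^ 3 * Z ^ 2 - X ^ 3 * Z + X ^ 2 * Z - X * Y * Z + X * Y - X * Z
      - X - Y + 1 + (X * Z - X + 1) * S₂) (by simp [X, Y, Z, hS₂.2])
    simpa only [hadd, hsub, hmul, hpow, hneg, hone] using this
  have hA₁ : ι S₁ = A₁ := rfl
  have hA₂ : ι S₂ = A₂ := rfl
  simp only [hadd, hsub, hmul, hpow, hone, htwo, hX, hY, hZ, hA₁, hA₂, one_mul, mul_one]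
    at e₁₁ f₁₁ g₁₁ e₂₁ f₂₁ g₂₁ e₁₂ f₁₂ g₁₂
  have hy' : -1 + y ≠ 0 := fun h => hy (by linear_combination -h)
  -- For 11 and 21 the weight `ζ₁₂` is 1, so the correction `ζ₁₂ - 1` vanishes. For 12 it remains,
  -- and dividing by `ζ₁₂ = z` accounts for the more complicated formula.
  have hC₁₁ : ι (faroSeries (faroWeight Polynomial.X 1 1)) = ι (descSeries Polynomial.X 1 1 0) :=
    mul_left_cancel₀ hy (by linear_combination f₁₁)
  have hC₂₁ : ι (faroSeries (faroWeight 1 1 Polynomial.X)) = ι (descSeries 1 1 Polynomial.X 0) :=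
    mul_left_cancel₀ hy (by linear_combination f₂₁)
  refine ⟨⟨hD₁₁, ?_⟩, ⟨hD₂₁, ?_⟩, mul_ne_zero (mul_ne_zero hE₁₂ hy') hz, hy, ?_⟩
  · rw [eq_div_iff hD₁₁, g₁₁, hC₁₁]
    linear_combination (-y) * e₁₁
  · rw [eq_div_iff hD₂₁, g₂₁, hC₂₁]
    linear_combination y * e₂₁
  · have hD₁₂ : D₁₂ ≠ 0 := mul_ne_zero (mul_ne_zero hE₁₂ hy') hz
    rw [div_add_div _ _ hD₁₂ hy, eq_div_iff (mul_ne_zero hD₁₂ hy), g₁₂]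
    simp only [D₁₂]
    linear_combination (-y) * (1 - y) * (x ^ 3 * z ^ 2 - x ^ 3 * z + x ^ 2 * z - x * y * z + x * y
      - x * z - x - y + 1 + (x * z - x + 1) * A₂) * f₁₂ - y * (1 - y) ^ 2 * e₁₂
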